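/- For metric spaces $X,Y$, a map $f:X\to Y$ is a coarse quotient map if - $\sup\{d_Y(f(x),f(y)) : d_X(x,y)\le t\}<\infty$ for every $t>0$, and - for some constant $K\ge 0$ the following holds: for every $d>K$ there is $\delta>0$ such that, for all $x\in X$, every point of the closed ball $B_Y(f(x),d)$ is at distance at most $K$ from some point of $f(B_X(x,\delta))$, where $B_X(x,\delta)$ is the closed ball. The space $Y$ is a coarse quotient of $X$ if there is a coarse quotient map from $X$ to $Y$. For a real Banach space $X$ with closed unit ball $B_X$, and $t>0$, put $$\bar\beta_X(t)=1-\sup\Big\{\inf_{n\ge1}\frac{\|x-x_n\|}{2} : x,x_n\in B_X,\ \inf_{i\ne j}\|x_i-x_j\|\ge t\Big\},$$ where the supremum of the empty set is $0$. The space $X$ has property $(\beta)$ if $\bar\beta_X(t)>0$ for all $t>0$. All sequence spaces below are real and indexed by $\mathbb N$, with their usual norms. (i) If $1<p<q<\infty$, then $\ell_q$ is not a coarse quotient of $\ell_p$. (ii) $c_0$ is not a coarse quotient of any real Banach space with property $(\beta)$. -/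

import Mathlib

open scoped ENNReal ZeroAtInfty

noncomputable section

/-- The modulus of continuity `ω_f(t) = sup {d(f x, f y) : d(x, y) ≤ t}`, with values in
`[0, ∞]`. -/
def modulusOfContinuity {X Y : Type*} [MetricSpace X] [MetricSpace Y] (f : X → Y) (t : ℝ) :
    ℝ≥0∞ :=
  ⨆ (x : X) (y : X) (_ : dist x y ≤ t), edist (f x) (f y)

/-- `f` is coarsely continuous: `ω_f(t) < ∞` for all `t > 0`. -/
def CoarselyContinuous {X Y : Type*} [MetricSpace X] [MetricSpace Y] (f : X → Y) : Prop :=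
  ∀ t : ℝ, 0 < t → modulusOfContinuity f t < ⊤

/-- The `K`-neighborhood `A^K` of a set: the points at distance at most `K` from some point
of `A`. -/
def neighborhoodOfRadius {X : Type*} [MetricSpace X] (K : ℝ) (A : Set X) : Set X :=
  {x | ∃ a ∈ A, dist x a ≤ K}

/-- `f` is co-coarsely continuous with constant `K`: for every `d > K` there is `δ > 0` such that
`B(f x, d) ⊆ f(B(x, δ))^K` for all `x`, the balls being closed. -/
def CoCoarselyContinuousWith {X Y : Type*} [MetricSpace X] [MetricSpace Y] (K : ℝ)
    (f : X → Y) : Prop :=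
  ∀ d : ℝ, K < d → ∃ δ : ℝ, 0 < δ ∧ ∀ x : X,
    Metric.closedBall (f x) d ⊆ neighborhoodOfRadius K (f '' Metric.closedBall x δ)

/-- `f` is a coarse quotient map with constant `K`. -/
def IsCoarseQuotientMapWith {X Y : Type*} [MetricSpace X] [MetricSpace Y] (K : ℝ)
    (f : X → Y) : Prop :=
  CoarselyContinuous f ∧ CoCoarselyContinuousWith K f

/-- `IsCoarseQuotient Y X`: the metric space `Y` is a coarse quotient of the metric space `X`,
that is, there is a coarse quotient map from `X` to `Y` (with some constant `K ≥ 0`). -/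
def IsCoarseQuotient (Y X : Type*) [MetricSpace Y] [MetricSpace X] : Prop :=
  ∃ (f : X → Y) (K : ℝ), 0 ≤ K ∧ IsCoarseQuotientMapWith K f

/-- The separation constant `inf_{i ≠ j} ‖u i - u j‖` of a sequence. -/
def sepConst {X : Type*} [NormedAddCommGroup X] (u : ℕ → X) : ℝ :=
  ⨅ p : {p : ℕ × ℕ // p.1 ≠ p.2}, ‖u p.1.1 - u p.1.2‖

/-- The `(β)`-modulus
`1 - sup {inf_n ‖x - u n‖ / 2 : x, u n in the closed unit ball, sep u ≥ t}`. The set is contained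
in `[0, 1]`; when the unit ball contains no sequence with separation constant at least `t`, its
supremum is `0` and the modulus is `1`. -/
def betaModulus (X : Type*) [NormedAddCommGroup X] (t : ℝ) : ℝ :=
  1 - sSup {r : ℝ | ∃ (x : X) (u : ℕ → X), x ∈ Metric.closedBall (0 : X) 1 ∧
    (∀ n, u n ∈ Metric.closedBall (0 : X) 1) ∧ t ≤ sepConst u ∧ r = ⨅ n, ‖x - u n‖ / 2}

/-- Property `(β)`: the `(β)`-modulus is positive at every `t > 0`. -/
def HasPropertyBeta (X : Type*) [NormedAddCommGroup X] : Prop :=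
  ∀ t : ℝ, 0 < t → 0 < betaModulus X t

end

/-!
A coarse quotient map `f : X → Y` between normed spaces is Lipschitz and co-Lipschitz at large
distances: balls of large radius `d` around `f x` lift, up to the error `K`, to balls of radius
`D * d` around `x`. The infimum `D₀` of the admissible slopes `D` is positive, because `f` is
Lipschitz at large distances (`liftSlopes_lower_bound`), and the proof consists in beating `D₀`.

To lift `f x + v` from `x`, one passes through a fork in `Y`: its centre lies over `v / 3`, its tips
lie over `2 * v / 3 + (d / 3) * w n` with separated perturbations `w n`, and the last third leads
from a tip to `f x + v`. If `Y` is asymptotically smooth (`HasSmoothForks`), the perturbations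
increase each of these distances by a factor of at most `1 + ρ`. In `X` the lifted tips form a
separated sequence in a ball around the lifted centre, as `f` is Lipschitz at large distances, and
`x` lies in that ball as well; property (β) therefore gives a tip closer to `x` than two radii, by a
factor governed by `betaModulus`. Going on from this tip yields a slope smaller than `D₀` as soon as
the gain from (β) exceeds the loss `ρ` (`mul_mem_liftSlopes_of_hasSmoothForks`). Hence
`betaModulus X (lam / M) ≤ 2 * ρ` with a constant `M` depending only on `f`
(`IsCoarseQuotient.exists_betaModulus_le`).

In `c₀` the separation can be `1` with `ρ` arbitrarily small, which contradicts property (β) of `X`.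
In `ℓ_q` the loss for separation `lam` is of order `lam ^ q`, whereas the `(β)`-modulus of `ℓ_p` is
at least a multiple of `lam ^ p` (`exists_mul_rpow_le_betaModulus_lp`); for `p < q` these are
incompatible as `lam → 0`.
-/

open Filter Topology

/-! ### Coarse maps on normed spaces at large scales -/

/-- Points near `f x` lift to points near `x`: every `y` within `d` of `f x` is, up to the error
`K`, the image of a point within `δ` of `x`. -/
def LiftsBalls {X Y : Type*} [MetricSpace X] [MetricSpace Y] (K : ℝ) (f : X → Y)
    (d δ : ℝ) : Prop :=
  ∀ x : X, ∀ y : Y, dist y (f x) ≤ d → ∃ x' : X, dist x' x ≤ δ ∧ dist y (f x') ≤ K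

/-- The slopes `D` for which balls of every large radius `d` in the range lift to balls of radius
`D * d`. The infimum of this set is the reciprocal of the best co-Lipschitz constant of `f` at
large distances. -/
def liftSlopes {X Y : Type*} [MetricSpace X] [MetricSpace Y] (K : ℝ) (f : X → Y) : Set ℝ :=
  {D | ∃ d₀ : ℝ, ∀ d, d₀ ≤ d → LiftsBalls K f d (D * d)}

section CoarseMaps

variable {X Y : Type*} [NormedAddCommGroup X] [NormedAddCommGroup Y] {K : ℝ} {f : X → Y}

/-- Subdividing segments shows that a coarsely continuous map on a normed space is Lipschitz at
large distances. -/
theorem CoarselyContinuous.exists_dist_le [NormedSpace ℝ X] (hf : CoarselyContinuous f) :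
    ∃ L : ℝ, 0 < L ∧ ∀ a b : X, dist (f a) (f b) ≤ L * (dist a b + 1) := by
  have h1 := hf 1 one_pos
  set ω := (modulusOfContinuity f 1).toReal
  have hω : ∀ a b : X, dist a b ≤ 1 → dist (f a) (f b) ≤ ω := by
    intro a b hab
    rw [dist_edist]
    refine ENNReal.toReal_mono h1.ne ?_
    exact le_iSup_of_le a (le_iSup_of_le b (le_iSup_of_le hab le_rfl))
  have hω0 : 0 ≤ ω := ENNReal.toReal_nonneg
  have hn : ∀ n : ℕ, ∀ a b : X, dist a b ≤ n → dist (f a) (f b) ≤ (ω + 1) * n := by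
    intro n
    induction n with
    | zero =>
      intro a b hab
      have : a = b := dist_le_zero.1 (by simpa using hab)
      simp [this]
    | succ k ih =>
      intro a b hab
      push_cast at hab ⊢
      have hk : (0 : ℝ) < k + 1 := by positivity
      let c := AffineMap.lineMap a b (1 / (k + 1 : ℝ))
      have hac : dist a c ≤ 1 := by
        rw [dist_left_lineMap, Real.norm_of_nonneg (by positivity), one_div_mul_eq_div,
          div_le_one hk]
        exact hab
      have hcb : dist c b ≤ k := by
        have h0 : 1 - 1 / (k + 1 : ℝ) = k / (k + 1) := by field_simp; ring
        rw [dist_lineMap_right, h0, Real.norm_of_nonneg (by positivity), div_mul_eq_mul_div,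
          div_le_iff₀ hk]
        exact mul_le_mul_of_nonneg_left hab (by positivity)
      have := dist_triangle (f a) (f c) (f b)
      linarith [hω a c hac, ih c b hcb]
  refine ⟨ω + 1, by linarith, fun a b => ?_⟩
  refine (hn _ a b (Nat.le_ceil _)).trans ?_
  exact mul_le_mul_of_nonneg_left (Nat.ceil_lt_add_one dist_nonneg).le (by linarith)

/-- Lifting the points of a subdivided segment one after another shows that a co-coarsely
continuous map into a normed space is co-Lipschitz at large distances. -/
theorem CoCoarselyContinuousWith.liftSlopes_nonempty [NormedSpace ℝ Y] (hK : 0 ≤ K)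
    (hf : CoCoarselyContinuousWith K f) : (liftSlopes K f).Nonempty := by
  obtain ⟨δ, hδ, h⟩ := hf (2 * K + 1) (by linarith)
  have hstep : LiftsBalls K f (2 * K + 1) δ := by
    intro x y hy
    obtain ⟨_, ⟨x', hx', rfl⟩, hd⟩ := h x (Metric.mem_closedBall.2 hy)
    exact ⟨x', hx', hd⟩
  have hn : ∀ n : ℕ, LiftsBalls K f (n + (2 * K + 1)) (δ * (n + 1)) := by
    intro n
    induction n with
    | zero => simpa using hstep
    | succ k ih =>
      intro x y hy
      push_cast at hy ⊢
      by_cases hle : dist y (f x) ≤ k + (2 * K + 1)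
      · obtain ⟨x', h1, h2⟩ := ih x y hle
        exact ⟨x', h1.trans (by nlinarith), h2⟩
      push Not at hle
      set r := dist y (f x)
      have hk : (0 : ℝ) ≤ k := k.cast_nonneg
      have hr : 0 < r := by linarith
      let z := AffineMap.lineMap (f x) y ((2 * K + 1) / r)
      have hz1 : dist z (f x) = 2 * K + 1 := by
        rw [dist_lineMap_left, Real.norm_of_nonneg (by positivity), dist_comm]
        exact div_mul_cancel₀ _ hr.ne'
      have hz2 : dist y z = r - (2 * K + 1) := by
        rw [dist_comm, dist_lineMap_right, Real.norm_of_nonneg, dist_comm]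
        · change _ * r = _
          field_simp
        · rw [sub_nonneg, div_le_one hr]
          linarith
      obtain ⟨a, ha1, ha2⟩ := hstep x z hz1.le
      have hya : dist y (f a) ≤ k + (2 * K + 1) := by
        linarith [dist_triangle y z (f a)]
      obtain ⟨x', h1, h2⟩ := ih a y hya
      exact ⟨x', by linarith [dist_triangle x' a x], h2⟩
  refine ⟨3 * δ, 1, fun d hd x y hy => ?_⟩
  have hc := Nat.le_ceil d
  have hc' := Nat.ceil_lt_add_one (zero_le_one.trans hd)
  obtain ⟨x', h1, h2⟩ := hn ⌈d⌉₊ x y (by linarith)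
  refine ⟨x', h1.trans ?_, h2⟩
  calc δ * (⌈d⌉₊ + 1) ≤ δ * (3 * d) := mul_le_mul_of_nonneg_left (by linarith) hδ.le
    _ = 3 * δ * d := by ring

/-- A map that is Lipschitz at large distances into an unbounded space cannot lift balls with
arbitrarily small slope. -/
theorem liftSlopes_lower_bound [NormedSpace ℝ Y] [Nontrivial Y] {L : ℝ}
    (hL : 0 < L) (hf : ∀ a b : X, dist (f a) (f b) ≤ L * (dist a b + 1)) {D : ℝ}
    (hD : D ∈ liftSlopes K f) :
    1 / (2 * L) ≤ D := by
  obtain ⟨d₀, h⟩ := hD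
  set d := max (max d₀ 1) (2 * (K + L)) with hd
  have hd0 : d₀ ≤ d := (le_max_left _ _).trans (le_max_left _ _)
  have hd1 : 1 ≤ d := (le_max_right _ _).trans (le_max_left _ _)
  have hd2 : 2 * (K + L) ≤ d := le_max_right _ _
  obtain ⟨v, hv⟩ := exists_norm_eq Y (zero_le_one.trans hd1)
  obtain ⟨x', h1, h2⟩ := h d hd0 0 (f 0 + v) (by simp [hv])
  have h3 : dist (f 0 + v) (f 0) = d := by simp [hv]
  have h4 := dist_triangle (f 0 + v) (f x') (f 0)
  have h5 := hf x' 0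
  have h6 : L * dist x' 0 ≤ L * (D * d) := mul_le_mul_of_nonneg_left h1 hL.le
  rw [div_le_iff₀ (by positivity)]
  by_contra hlt
  push Not at hlt
  nlinarith

end CoarseMaps

/-! ### The modulus of property (β) -/

section Beta

variable {X : Type*} [NormedAddCommGroup X]

theorem le_sepConst_iff {u : ℕ → X} {t : ℝ} :
    t ≤ sepConst u ↔ ∀ n m, n ≠ m → t ≤ ‖u n - u m‖ := by
  have : Nonempty {p : ℕ × ℕ // p.1 ≠ p.2} := ⟨⟨(0, 1), by simp⟩⟩
  constructor
  · intro h n m hnm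
    exact h.trans (ciInf_le (f := fun p : {p : ℕ × ℕ // p.1 ≠ p.2} => ‖u p.1.1 - u p.1.2‖)
      ⟨0, by rintro _ ⟨p, rfl⟩; positivity⟩ ⟨(n, m), hnm⟩)
  · intro h
    exact le_ciInf fun p => h _ _ p.2

theorem bddBelow_range_half_dist (x : X) (u : ℕ → X) :
    BddBelow (Set.range fun n => ‖x - u n‖ / 2) :=
  ⟨0, by rintro _ ⟨p, rfl⟩; positivity⟩

/-- In the unit ball, some term of a `t`-separated sequence is within `2 * (1 - b)` of a given
point, for every `b < betaModulus X t`. -/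
theorem exists_norm_sub_lt_of_lt_betaModulus {t b : ℝ} (hb : b < betaModulus X t) {x : X}
    {u : ℕ → X} (hx : ‖x‖ ≤ 1) (hu : ∀ n, ‖u n‖ ≤ 1) (hsep : ∀ n m, n ≠ m → t ≤ ‖u n - u m‖) :
    ∃ n, ‖x - u n‖ < 2 * (1 - b) := by
  have hle : ⨅ n, ‖x - u n‖ / 2 ≤ 1 - betaModulus X t := by
    rw [betaModulus, sub_sub_cancel]
    refine le_csSup ⟨1, ?_⟩ ⟨x, u, by simpa using hx, by simpa using hu,
      le_sepConst_iff.2 hsep, rfl⟩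
    rintro _ ⟨y, v, hy, hv, -, rfl⟩
    refine (ciInf_le (bddBelow_range_half_dist y v) 0).trans ?_
    have h1 := norm_sub_le y (v 0)
    have h2 : ‖y‖ ≤ 1 := by simpa using hy
    have h3 : ‖v 0‖ ≤ 1 := by simpa using hv 0
    linarith
  obtain ⟨n, hn⟩ := exists_lt_of_ciInf_lt (lt_of_le_of_lt hle (by linarith : _ < 1 - b))
  exact ⟨n, by linarith⟩

/-- The scaled form of `exists_norm_sub_lt_of_lt_betaModulus`, in a ball with centre `c` and
radius `R`. -/
theorem exists_norm_sub_lt_of_lt_betaModulus_ball [NormedSpace ℝ X] {t b R : ℝ}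
    (hb : b < betaModulus X t) (hR : 0 < R) {x c : X} {u : ℕ → X} (hx : ‖x - c‖ ≤ R)
    (hu : ∀ n, ‖u n - c‖ ≤ R) (hsep : ∀ n m, n ≠ m → t * R ≤ ‖u n - u m‖) :
    ∃ n, ‖x - u n‖ < 2 * R * (1 - b) := by
  have hnorm : ∀ z : X, ‖R⁻¹ • z‖ = ‖z‖ / R := fun z => by
    rw [norm_smul, norm_inv, Real.norm_of_nonneg hR.le, inv_mul_eq_div]
  obtain ⟨n, hn⟩ := exists_norm_sub_lt_of_lt_betaModulus hb (x := R⁻¹ • (x - c))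
    (u := fun n => R⁻¹ • (u n - c)) (by rwa [hnorm, div_le_one hR])
    (fun n => by rw [hnorm, div_le_one hR]; exact hu n)
    (fun n m hnm => by
      rw [← smul_sub, hnorm, le_div_iff₀ hR, sub_sub_sub_cancel_right]
      exact hsep n m hnm)
  refine ⟨n, ?_⟩
  rw [← smul_sub, hnorm, sub_sub_sub_cancel_right, div_lt_iff₀ hR] at hn
  linarith

theorem le_betaModulus {t b : ℝ} (hb : b ≤ 1)
    (h : ∀ (x : X) (u : ℕ → X), ‖x‖ ≤ 1 → (∀ n, ‖u n‖ ≤ 1) →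
      (∀ n m, n ≠ m → t ≤ ‖u n - u m‖) → ∀ ε > 0, ∃ n, ‖x - u n‖ ≤ 2 * (1 - b) + ε) :
    b ≤ betaModulus X t := by
  rw [betaModulus, le_sub_comm]
  refine Real.sSup_le ?_ (by linarith)
  rintro _ ⟨x, u, hx, hu, hsep, rfl⟩
  refine le_of_forall_pos_le_add fun ε hε => ?_
  obtain ⟨n, hn⟩ := h x u (by simpa using hx) (by simpa using hu) (le_sepConst_iff.1 hsep) ε hε
  exact (ciInf_le (bddBelow_range_half_dist x u) n).trans (by linarith)

end Beta

/-! ### The fork argument -/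

/-- Every vector `u` of the unit ball admits a `lam`-separated sequence of perturbations `w n` such
that neither `u + w n` nor `u - w n` has norm above `1 + ρ`. The least such `ρ` measures the
asymptotic uniform smoothness of the space at `lam`. -/
def HasSmoothForks (Y : Type*) [NormedAddCommGroup Y] (lam ρ : ℝ) : Prop :=
  ∀ u : Y, ‖u‖ ≤ 1 → ∃ w : ℕ → Y, (∀ n m, n ≠ m → lam ≤ ‖w n - w m‖) ∧
    ∀ n, ‖u + w n‖ ≤ 1 + ρ ∧ ‖u - w n‖ ≤ 1 + ρ

section Fork

variable {X Y : Type*} [NormedAddCommGroup X] [NormedSpace ℝ X] [NormedAddCommGroup Y]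
  [NormedSpace ℝ Y] {K : ℝ} {f : X → Y}

/-- A slope can be improved by the factor `(1 + ρ) * (1 - 2 * b / 3)`, up to an arbitrarily small
`η`. To lift `y` from `x`, put `v = y - f x` and lift `f x + v / 3` from `x` to a centre `c`, then
lift the tips `f x + 2 * v / 3 + (d / 3) * w n` of a fork from `c`, then lift `y` from the tip whose
lift property (β) places close to `x`. The hypothesis `ht` guarantees that the lifted tips, which
all lie within `D * d` of `c`, are `t`-separated relative to that radius. -/
theorem mul_mem_liftSlopes_of_hasSmoothForks (hK : 0 ≤ K) {L : ℝ} (hL : 0 < L)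
    (hf : ∀ a b : X, dist (f a) (f b) ≤ L * (dist a b + 1)) {lam ρ t b D η : ℝ} (hlam : 0 < lam)
    (hρ : 0 ≤ ρ) (hρ1 : ρ ≤ 1) (hY : HasSmoothForks Y lam ρ) (ht0 : 0 ≤ t) (hb0 : 0 ≤ b)
    (hb : b < betaModulus X t) (hη : 0 < η) (hD0 : 0 < D) (ht : t * (6 * L * D) ≤ lam)
    (hD : D ∈ liftSlopes K f) : ((1 + ρ) * (1 - 2 * b / 3) + η) * D ∈ liftSlopes K f := by
  obtain ⟨d₀, h⟩ := hD
  -- Beyond `d₁` the error `K` and the additive constant in `hf` are negligible against `d`.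
  set d₁ := max 1 (max (3 * d₀) (max (3 * K) (max (3 * K / η) (6 * (2 * K + L) / lam)))) with hd₁
  refine ⟨d₁, fun d hd => ?_⟩
  simp only [hd₁, max_le_iff] at hd
  obtain ⟨e1, e2, e3, e4, e5⟩ := hd
  have hd0 : 0 < d := by linarith
  rw [div_le_iff₀ hη] at e4
  rw [div_le_iff₀ hlam] at e5
  intro x y hy
  obtain ⟨v, rfl⟩ : ∃ v, y = f x + v := ⟨y - f x, by abel⟩
  have hv : ‖v‖ ≤ d := by simpa using hy
  obtain ⟨w, hwsep, hw⟩ := hY (d⁻¹ • v) (by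
    rw [norm_smul, norm_inv, Real.norm_of_nonneg hd0.le, inv_mul_le_one₀ hd0]; exact hv)
  have hnorm : ∀ z : Y, ‖(d / 3) • z‖ = d / 3 * ‖z‖ := fun z => by
    rw [norm_smul, Real.norm_of_nonneg (by positivity)]
  have hscale : (d / 3) • (d⁻¹ • v) = (1 / 3 : ℝ) • v := by
    rw [smul_smul]; congr 1; field_simp
  obtain ⟨c, hc1, hc2⟩ := h (d / 3) (by linarith) x (f x + (1 / 3 : ℝ) • v) (by
    rw [dist_eq_norm, add_sub_cancel_left, norm_smul, Real.norm_of_nonneg (by norm_num)]; linarith)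
  set r := d / 3 * (1 + ρ) + K with hr
  have hr0 : d / 3 ≤ r := by nlinarith
  have hr1 : r ≤ d := by nlinarith
  have hR : 0 < D * r := by apply mul_pos hD0; linarith
  have htip : ∀ n, ∃ a, dist a c ≤ D * r ∧
      dist (f x + (2 / 3 : ℝ) • v + (d / 3) • w n) (f a) ≤ K := by
    intro n
    refine h r (by linarith) c _ ?_
    have h1 : dist (f x + (2 / 3 : ℝ) • v + (d / 3) • w n) (f x + (1 / 3 : ℝ) • v)
        = d / 3 * ‖d⁻¹ • v + w n‖ := by
      rw [dist_eq_norm, ← hnorm, smul_add, hscale]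
      congr 1
      module
    have h2 : d / 3 * ‖d⁻¹ • v + w n‖ ≤ d / 3 * (1 + ρ) :=
      mul_le_mul_of_nonneg_left (hw n).1 (by positivity)
    linarith [dist_triangle (f x + (2 / 3 : ℝ) • v + (d / 3) • w n) (f x + (1 / 3 : ℝ) • v) (f c)]
  choose a ha1 ha2 using htip
  have hsep : ∀ n m, n ≠ m → t * (D * r) ≤ ‖a n - a m‖ := by
    intro n m hnm
    have h1 : dist (f x + (2 / 3 : ℝ) • v + (d / 3) • w n)
        (f x + (2 / 3 : ℝ) • v + (d / 3) • w m) = d / 3 * ‖w n - w m‖ := by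
      rw [dist_add_left, dist_eq_norm, ← smul_sub, hnorm]
    have h2 : d / 3 * lam ≤ d / 3 * ‖w n - w m‖ :=
      mul_le_mul_of_nonneg_left (hwsep n m hnm) (by positivity)
    have h3 := dist_triangle4 (f x + (2 / 3 : ℝ) • v + (d / 3) • w n) (f (a n)) (f (a m))
      (f x + (2 / 3 : ℝ) • v + (d / 3) • w m)
    have h4 := hf (a n) (a m)
    have h5 := ha2 m
    rw [dist_comm] at h5
    rw [← dist_eq_norm]
    have h6 : d * lam / 6 ≤ L * dist (a n) (a m) := by linarith [ha2 n]
    have h7 : t * (6 * L * D) * d ≤ lam * d := mul_le_mul_of_nonneg_right ht hd0.le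
    have h8 : L * (t * (D * r)) ≤ L * (t * (D * d)) := by gcongr
    refine le_of_mul_le_mul_left ?_ hL
    linarith
  obtain ⟨n, hn⟩ := exists_norm_sub_lt_of_lt_betaModulus_ball hb hR (x := x) (c := c) (u := a)
    (by
      rw [← dist_eq_norm, dist_comm]
      exact hc1.trans (mul_le_mul_of_nonneg_left hr0 hD0.le))
    (fun n => by rw [← dist_eq_norm]; exact ha1 n) hsep
  obtain ⟨x', hx1, hx2⟩ := h r (by linarith) (a n) (f x + v) (by
    have h1 : dist (f x + v) (f x + (2 / 3 : ℝ) • v + (d / 3) • w n)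
        = d / 3 * ‖d⁻¹ • v - w n‖ := by
      rw [dist_eq_norm, ← hnorm, smul_sub, hscale]
      congr 1
      module
    have h2 : d / 3 * ‖d⁻¹ • v - w n‖ ≤ d / 3 * (1 + ρ) :=
      mul_le_mul_of_nonneg_left (hw n).2 (by positivity)
    linarith [dist_triangle (f x + v) (f x + (2 / 3 : ℝ) • v + (d / 3) • w n) (f (a n)), ha2 n])
  refine ⟨x', ?_, hx2⟩
  rw [← dist_eq_norm, dist_comm] at hn
  have h1 := dist_triangle x' (a n) x
  have h2 : dist x' x ≤ D * r * (3 - 2 * b) := by linarith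
  have h3 : D * (K * (3 - 2 * b)) ≤ D * (d * η) :=
    mul_le_mul_of_nonneg_left (by nlinarith) hD0.le
  refine h2.trans ?_
  rw [hr]
  linarith

/-- The quantitative obstruction: if the range of a coarse quotient map has smooth forks, then the
`(β)`-modulus of the domain is at most of the order of the smoothness of these forks. -/
theorem IsCoarseQuotient.exists_betaModulus_le [Nontrivial Y] (h : IsCoarseQuotient Y X) :
    ∃ M : ℝ, 0 < M ∧ ∀ lam ρ : ℝ, 0 < lam → 0 ≤ ρ → ρ ≤ 1 → HasSmoothForks Y lam ρ →
      betaModulus X (lam / M) ≤ 2 * ρ := by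
  obtain ⟨f, K, hK, hf, hco⟩ := h
  obtain ⟨L, hL, hLip⟩ := hf.exists_dist_le
  have hne := hco.liftSlopes_nonempty hK
  have hlow : ∀ D ∈ liftSlopes K f, 1 / (2 * L) ≤ D := fun D hD =>
    liftSlopes_lower_bound hL hLip hD
  set D₀ := sInf (liftSlopes K f)
  have hbdd : BddBelow (liftSlopes K f) := ⟨_, hlow⟩
  have hD₀ : 0 < D₀ := lt_of_lt_of_le (by positivity) (le_csInf hne hlow)
  refine ⟨12 * L * D₀, by positivity, fun lam ρ hlam hρ hρ1 hY => ?_⟩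
  by_contra! hlt
  obtain ⟨b, hb1, hb2⟩ := exists_between hlt
  have hb0 : 0 < b := by linarith
  -- For `2 * ρ < b` the improvement factor is below `1`, and half of the gap is spent on `η`.
  set θ₀ := (1 + ρ) * (1 - 2 * b / 3) with hθ₀
  have hθ₀1 : θ₀ < 1 := by nlinarith
  set η := (1 - θ₀) / 2 with hη
  have hη0 : 0 < η := by linarith
  have hfac : ∀ D ∈ liftSlopes K f, D < 2 * D₀ → D₀ ≤ (θ₀ + η) * D := by
    intro D hD hD2
    have hD0 : D₀ ≤ D := csInf_le hbdd hD
    refine csInf_le hbdd (mul_mem_liftSlopes_of_hasSmoothForks hK hL hLip hlam hρ hρ1 hY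
      (by positivity) hb0.le hb2 hη0 (hD₀.trans_le hD0) ?_ hD)
    rw [div_mul_eq_mul_div, div_le_iff₀ (by positivity)]
    refine mul_le_mul_of_nonneg_left ?_ hlam.le
    nlinarith
  obtain ⟨D, hD, hDlt⟩ := exists_lt_of_csInf_lt hne
    (show sInf (liftSlopes K f) < D₀ * (1 + min η 1 / 2) by
      change D₀ < _
      have : 0 < min η 1 := lt_min hη0 one_pos
      nlinarith)
  have hm1 : min η 1 ≤ 1 := min_le_right _ _
  have hm2 : min η 1 ≤ η := min_le_left _ _
  have h1 := hfac D hD (by nlinarith)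
  have hD0 : D₀ ≤ D := csInf_le hbdd hD
  have h2 : θ₀ + η = 1 - η := by rw [hη]; ring
  rw [h2] at h1
  nlinarith

end Fork

/-! ### Smooth forks in `c₀` -/

/-- The `n`-th unit vector of `c₀`. -/
noncomputable def unitVecC0 (n : ℕ) : C₀(ℕ, ℝ) where
  toFun := Pi.single n 1
  continuous_toFun := continuous_of_discreteTopology
  zero_at_infty' := by
    rw [cocompact_eq_cofinite]
    refine tendsto_const_nhds.congr' ?_
    filter_upwards [(Set.finite_singleton n).compl_mem_cofinite] with i hi
    simp [show i ≠ n from hi]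

theorem norm_c0_le {g : C₀(ℕ, ℝ)} {C : ℝ} (hC : 0 ≤ C) (h : ∀ i, |g i| ≤ C) : ‖g‖ ≤ C := by
  rw [← ZeroAtInftyContinuousMap.norm_toBCF_eq_norm, BoundedContinuousFunction.norm_le hC]
  exact h

theorem abs_c0_apply_le_norm (g : C₀(ℕ, ℝ)) (i : ℕ) : |g i| ≤ ‖g‖ := by
  rw [← ZeroAtInftyContinuousMap.norm_toBCF_eq_norm]
  exact g.toBCF.norm_coe_le_norm i

instance : Nontrivial C₀(ℕ, ℝ) :=
  ⟨unitVecC0 0, 0, fun h => by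
    have : unitVecC0 0 0 = (0 : C₀(ℕ, ℝ)) 0 := by rw [h]
    simp [unitVecC0] at this⟩

theorem hasSmoothForks_c0 {ρ : ℝ} (hρ : 0 < ρ) : HasSmoothForks C₀(ℕ, ℝ) 1 ρ := by
  intro u hu
  have hlim : Tendsto u atTop (𝓝 0) := by
    have := u.zero_at_infty'
    rwa [cocompact_eq_cofinite, Nat.cofinite_eq_atTop] at this
  obtain ⟨N, hN⟩ := (Metric.tendsto_atTop.1 hlim) ρ hρ
  have happ : ∀ n i, unitVecC0 n i = if i = n then 1 else 0 := fun n i => by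
    simp [unitVecC0, Pi.single_apply]
  have hmain : ∀ (s : ℝ), |s| ≤ 1 → ∀ n, ‖u + s • unitVecC0 (N + n)‖ ≤ 1 + ρ := by
    intro s hs n
    refine norm_c0_le (by linarith) fun i => ?_
    simp only [ZeroAtInftyContinuousMap.add_apply, ZeroAtInftyContinuousMap.smul_apply, happ,
      smul_eq_mul]
    split_ifs with hi
    · have h1 := hN i (by omega)
      rw [Real.dist_0_eq_abs] at h1
      have := abs_add_le (u i) (s * 1)
      rw [mul_one] at this ⊢
      linarith
    · rw [mul_zero, add_zero]
      linarith [abs_c0_apply_le_norm u i]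
  refine ⟨fun n => unitVecC0 (N + n), fun n m hnm => ?_, fun n => ⟨?_, ?_⟩⟩
  · have := abs_c0_apply_le_norm (unitVecC0 (N + n) - unitVecC0 (N + m)) (N + n)
    simpa [happ, hnm] using this
  · simpa using hmain 1 (by simp) n
  · have h1 : u - unitVecC0 (N + n) = u + (-1 : ℝ) • unitVecC0 (N + n) := by
      ext i
      simp [sub_eq_add_neg]
    rw [h1]
    exact hmain (-1) (by simp) n

/-! ### The sequence spaces `ℓ_p` -/

section Lp

variable {p : ℝ≥0∞}

theorem norm_add_rpow_of_disjoint (hp : 0 < p.toReal) (g h : lp (fun _ : ℕ => ℝ) p)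
    (hgh : ∀ i, g i = 0 ∨ h i = 0) :
    ‖g + h‖ ^ p.toReal = ‖g‖ ^ p.toReal + ‖h‖ ^ p.toReal := by
  refine (lp.hasSum_norm hp (g + h)).unique ?_
  convert (lp.hasSum_norm hp g).add (lp.hasSum_norm hp h) using 2 with i
  rcases hgh i with h0 | h0 <;> simp [h0, Real.zero_rpow hp.ne']

/-- The truncation of a sequence to its first `N` coordinates. -/
noncomputable def truncLp (N : ℕ) (g : lp (fun _ : ℕ => ℝ) p) : lp (fun _ : ℕ => ℝ) p :=
  ∑ i ∈ Finset.range N, lp.single p i (g i)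

theorem truncLp_apply (N : ℕ) (g : lp (fun _ : ℕ => ℝ) p) (i : ℕ) :
    truncLp N g i = if i < N then g i else 0 := by
  simp only [truncLp, lp.coeFn_sum, Finset.sum_apply, lp.coeFn_single, Finset.sum_pi_single,
    Finset.mem_range]

theorem truncLp_sub (N : ℕ) (g h : lp (fun _ : ℕ => ℝ) p) :
    truncLp N (g - h) = truncLp N g - truncLp N h := by
  simp [truncLp, Finset.sum_sub_distrib]

theorem norm_truncLp_rpow_add (hp : 0 < p.toReal) (N : ℕ) (g : lp (fun _ : ℕ => ℝ) p) :
    ‖truncLp N g‖ ^ p.toReal + ‖g - truncLp N g‖ ^ p.toReal = ‖g‖ ^ p.toReal := by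
  rw [← norm_add_rpow_of_disjoint hp, add_sub_cancel]
  intro i
  rw [lp.coeFn_sub, Pi.sub_apply, truncLp_apply]
  split_ifs <;> simp

theorem norm_truncLp_le_sum [Fact (1 ≤ p)] (hp : 0 < p) (N : ℕ) (g : lp (fun _ : ℕ => ℝ) p) :
    ‖truncLp N g‖ ≤ ∑ i ∈ Finset.range N, |g i| := by
  refine (norm_sum_le _ _).trans (le_of_eq ?_)
  simp [lp.norm_single hp]

theorem tendsto_truncLp [Fact (1 ≤ p)] (hp : p ≠ ⊤) (g : lp (fun _ : ℕ => ℝ) p) :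
    Tendsto (fun N => truncLp N g) atTop (𝓝 g) :=
  (lp.hasSum_single hp g).tendsto_sum_nat

/-- Two terms of a bounded sequence nearly agree on their first `N` coordinates. -/
theorem exists_norm_truncLp_sub_le [Fact (1 ≤ p)] {u : ℕ → lp (fun _ : ℕ => ℝ) p}
    (hu : ∀ n, ‖u n‖ ≤ 1) (N : ℕ) {ε : ℝ} (hε : 0 < ε) :
    ∃ n m, n ≠ m ∧ ‖truncLp N (u n - u m)‖ ≤ ε := by
  have hp0 : p ≠ 0 := (zero_lt_one.trans_le Fact.out).ne'
  let z : ℕ → (Fin N → ℝ) := fun n i => u n i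
  obtain ⟨a, -, φ, hφ, hlim⟩ := tendsto_subseq_of_bounded (x := z)
    (Metric.isBounded_closedBall (x := 0) (r := 1)) fun n => by
      rw [mem_closedBall_zero_iff, pi_norm_le_iff_of_nonneg zero_le_one]
      exact fun i => (lp.norm_apply_le_norm hp0 (u n) i).trans (hu n)
  have hN : 0 < (N + 1 : ℝ) := by positivity
  obtain ⟨k, hk⟩ := Metric.cauchySeq_iff'.1 hlim.cauchySeq (ε / (N + 1)) (by positivity)
  refine ⟨φ (k + 1), φ k, (hφ (Nat.lt_succ_self k)).ne', ?_⟩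
  refine (norm_truncLp_le_sum (pos_iff_ne_zero.2 hp0) N _).trans ?_
  have hle : ∀ i ∈ Finset.range N, |(u (φ (k + 1)) - u (φ k)) i| ≤ ε / (N + 1) := by
    intro i hi
    have h1 := (dist_le_pi_dist (z (φ (k + 1))) (z (φ k)) ⟨i, Finset.mem_range.1 hi⟩).trans
      (hk (k + 1) (Nat.le_succ k)).le
    simpa [z, Real.dist_eq] using h1
  refine (Finset.sum_le_card_nsmul _ _ _ hle).trans ?_
  rw [Finset.card_range, nsmul_eq_mul, mul_div_assoc', div_le_iff₀ hN]
  linarith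

theorem add_rpow_le_two_rpow_mul {a b r : ℝ} (ha : 0 ≤ a) (hb : 0 ≤ b) (hr : 1 ≤ r) :
    (a + b) ^ r ≤ 2 ^ (r - 1) * (a ^ r + b ^ r) := by
  lift a to NNReal using ha
  lift b to NNReal using hb
  exact_mod_cast NNReal.rpow_add_le_mul_rpow_add_rpow a b hr

/-- The `(β)`-modulus of `ℓ_p`, `1 < p < ∞`, has power type `p`. Two terms of a separated sequence
that nearly agree on the coordinates carrying `x` cannot both have a small tail; by convexity of
the `p`-th power, a tail of `p`-th power `s` shortens the distance to `x`, because the head has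
`p`-th power at most `1 - s`. -/
theorem exists_mul_rpow_le_betaModulus_lp [Fact (1 ≤ p)] (hp1 : 1 < p) (hp : p ≠ ⊤) :
    ∃ c : ℝ, 0 < c ∧ ∀ t : ℝ, 0 < t → t ≤ 1 →
      c * t ^ p.toReal ≤ betaModulus (lp (fun _ : ℕ => ℝ) p) t := by
  set r := p.toReal with hrdef
  have hr1 : 1 < r := by
    have := (ENNReal.toReal_lt_toReal ENNReal.one_ne_top hp).2 hp1
    simpa using this
  have hr0 : 0 < r := by linarith
  have h2r : (2 : ℝ) ^ r = 2 * 2 ^ (r - 1) := by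
    rw [Real.rpow_sub two_pos, Real.rpow_one]; ring
  have h2r1 : 1 < (2 : ℝ) ^ (r - 1) := Real.one_lt_rpow one_lt_two (by linarith)
  set κ := ((2 : ℝ) ^ (r - 1) - 1) / 2 ^ r with hκ
  have hκ0 : 0 < κ := div_pos (by linarith) (by positivity)
  have hκ1 : κ ≤ 1 := by
    rw [hκ, div_le_one (by positivity)]; linarith
  have h4 : (0 : ℝ) < (1 / 4) ^ r := by positivity
  have h41 : (1 / 4 : ℝ) ^ r ≤ 1 := Real.rpow_le_one (by norm_num) (by norm_num) hr0.le
  refine ⟨κ * (1 / 4) ^ r / r, by positivity, fun t ht ht1 => ?_⟩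
  have htr : t ^ r ≤ 1 := Real.rpow_le_one ht.le ht1 hr0.le
  have htr0 : 0 < t ^ r := by positivity
  set q := κ * ((1 / 4) ^ r * t ^ r) with hq
  have hq1 : q ≤ 1 := by
    have : (1 / 4 : ℝ) ^ r * t ^ r ≤ 1 := mul_le_one₀ h41 htr0.le htr
    exact mul_le_one₀ hκ1 (by positivity) this
  have hq0 : 0 < q := by positivity
  have hqr : κ * (1 / 4) ^ r / r * t ^ r = q / r := by rw [hq]; ring
  rw [hqr]
  have hqr1 : q / r ≤ 1 := by rw [div_le_one hr0]; linarith
  refine le_betaModulus hqr1 fun x u hx hu hsep ε hε => ?_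
  obtain ⟨N, hN⟩ := Metric.tendsto_atTop.1 (tendsto_truncLp hp x) ε hε
  have hxN : ‖x - truncLp N x‖ ≤ ε := by
    rw [← dist_eq_norm, dist_comm]; exact (hN N le_rfl).le
  obtain ⟨n, m, hnm, hclose⟩ := exists_norm_truncLp_sub_le hu N (half_pos ht)
  have htail : t / 2 ≤ ‖u n - truncLp N (u n)‖ + ‖u m - truncLp N (u m)‖ := by
    have h1 := hsep n m hnm
    have h2 : u n - u m = truncLp N (u n - u m) +
        ((u n - truncLp N (u n)) - (u m - truncLp N (u m))) := by
      rw [truncLp_sub]; abel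
    have h3 := norm_add_le (truncLp N (u n - u m))
      ((u n - truncLp N (u n)) - (u m - truncLp N (u m)))
    rw [← h2] at h3
    linarith [norm_sub_le (u n - truncLp N (u n)) (u m - truncLp N (u m))]
  obtain ⟨k, hk⟩ : ∃ k, t / 4 ≤ ‖u k - truncLp N (u k)‖ := by
    by_cases h : t / 4 ≤ ‖u n - truncLp N (u n)‖
    · exact ⟨n, h⟩
    · exact ⟨m, by linarith⟩
  refine ⟨k, ?_⟩
  set s := ‖u k - truncLp N (u k)‖ ^ r with hs
  have hst : (1 / 4) ^ r * t ^ r ≤ s := by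
    rw [← Real.mul_rpow (by norm_num) ht.le]
    exact Real.rpow_le_rpow (by positivity) (by linarith) hr0.le
  have hhead : ‖truncLp N (u k)‖ ^ r + s ≤ 1 := by
    rw [hs, norm_truncLp_rpow_add hr0]
    exact Real.rpow_le_one (norm_nonneg _) (hu k) hr0.le
  have hxhead : ‖truncLp N x‖ ^ r ≤ 1 := by
    have h1 := norm_truncLp_rpow_add hr0 N x
    have h2 : ‖x‖ ^ r ≤ 1 := Real.rpow_le_one (norm_nonneg _) hx hr0.le
    have h3 : 0 ≤ ‖x - truncLp N x‖ ^ r := by positivity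
    linarith
  have hsplit : ‖truncLp N x - u k‖ ^ r = ‖truncLp N x - truncLp N (u k)‖ ^ r + s := by
    have h1 : truncLp N x - u k =
        (truncLp N x - truncLp N (u k)) + -(u k - truncLp N (u k)) := by abel
    rw [h1, norm_add_rpow_of_disjoint hr0, norm_neg]
    intro i
    simp only [lp.coeFn_sub, lp.coeFn_neg, Pi.sub_apply, Pi.neg_apply, truncLp_apply]
    split_ifs <;> simp
  have hpow : ‖truncLp N x - u k‖ ^ r ≤ 2 ^ r * (1 - q) := by
    have h1 : ‖truncLp N x - truncLp N (u k)‖ ^ r ≤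
        2 ^ (r - 1) * (‖truncLp N x‖ ^ r + ‖truncLp N (u k)‖ ^ r) :=
      (Real.rpow_le_rpow (norm_nonneg _) (norm_sub_le _ _) hr0.le).trans
        (add_rpow_le_two_rpow_mul (norm_nonneg _) (norm_nonneg _) hr1.le)
    have h2 : 2 ^ (r - 1) * (‖truncLp N x‖ ^ r + ‖truncLp N (u k)‖ ^ r) ≤
        2 ^ (r - 1) * (1 + (1 - s)) :=
      mul_le_mul_of_nonneg_left (by linarith) (by positivity)
    have h3 : 2 ^ r * q = (2 ^ (r - 1) - 1) * ((1 / 4) ^ r * t ^ r) := by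
      rw [hq, hκ]; field_simp
    have h4 : (2 ^ (r - 1) - 1) * ((1 / 4) ^ r * t ^ r) ≤ (2 ^ (r - 1) - 1) * s :=
      mul_le_mul_of_nonneg_left hst (by linarith)
    rw [hsplit, mul_sub, h3]
    linarith
  have hdist : ‖truncLp N x - u k‖ ≤ 2 * (1 - q / r) := by
    -- Bernoulli's inequality removes the `r`-th root.
    have h1 : 1 - q ≤ (1 - q / r) ^ r := by
      have := one_add_mul_self_le_rpow_one_add (s := -(q / r)) (by linarith) hr1.le
      rw [mul_neg, mul_div_cancel₀ _ hr0.ne'] at this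
      simpa [sub_eq_add_neg] using this
    rw [← Real.rpow_le_rpow_iff (norm_nonneg _) (by linarith) hr0,
      Real.mul_rpow two_pos.le (by linarith)]
    exact hpow.trans (mul_le_mul_of_nonneg_left h1 (by positivity))
  have := norm_sub_le_norm_sub_add_norm_sub x (truncLp N x) (u k)
  linarith

/-- In `ℓ_p` the perturbations are far unit vectors scaled by `lam`. -/
theorem hasSmoothForks_lp [Fact (1 ≤ p)] (hp : p ≠ ⊤) {lam : ℝ} (hlam : 0 < lam) :
    HasSmoothForks (lp (fun _ : ℕ => ℝ) p) lam (2 * lam ^ p.toReal) := by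
  have hp0 : 0 < p := zero_lt_one.trans_le Fact.out
  set r := p.toReal with hrdef
  have hr1 : 1 ≤ r := by
    have := (ENNReal.toReal_le_toReal ENNReal.one_ne_top hp).2 (Fact.out : 1 ≤ p)
    simpa using this
  have hr0 : 0 < r := by linarith
  intro u hu
  have hlr : 0 < lam ^ r := by positivity
  obtain ⟨N, hN⟩ := Metric.tendsto_atTop.1 (tendsto_truncLp hp u) (lam ^ r) hlr
  have huN : ‖u - truncLp N u‖ ≤ lam ^ r := by
    rw [← dist_eq_norm, dist_comm]; exact (hN N le_rfl).le
  have htr : ‖truncLp N u‖ ^ r ≤ 1 := by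
    have h1 := norm_truncLp_rpow_add hr0 N u
    have h2 : ‖u‖ ^ r ≤ 1 := Real.rpow_le_one (norm_nonneg _) hu hr0.le
    have h3 : 0 ≤ ‖u - truncLp N u‖ ^ r := by positivity
    linarith
  have hsingle : ∀ (n : ℕ) (s : ℝ), |s| = lam →
      ‖u + lp.single p (N + n) s‖ ≤ 1 + 2 * lam ^ r := by
    intro n s hs
    have h1 : ‖truncLp N u + lp.single p (N + n) s‖ ^ r ≤ 1 + lam ^ r := by
      rw [norm_add_rpow_of_disjoint hr0, lp.norm_single hp0, Real.norm_eq_abs, hs]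
      · linarith
      · intro i
        by_cases hi : i < N
        · exact Or.inr (lp.single_apply_ne p _ _ (by omega))
        · exact Or.inl (by rw [truncLp_apply, if_neg hi])
    have h2 : ‖truncLp N u + lp.single p (N + n) s‖ ≤ 1 + lam ^ r := by
      rw [← Real.rpow_le_rpow_iff (norm_nonneg _) (by linarith) hr0]
      exact h1.trans (Real.self_le_rpow_of_one_le (by linarith) hr1)
    have h3 : u + lp.single p (N + n) s =
        (u - truncLp N u) + (truncLp N u + lp.single p (N + n) s) := by abel
    rw [h3]
    linarith [norm_add_le (u - truncLp N u) (truncLp N u + lp.single p (N + n) s)]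
  refine ⟨fun n => lp.single p (N + n) lam, fun n m hnm => ?_, fun n => ⟨?_, ?_⟩⟩
  · have h1 := lp.norm_apply_le_norm hp0.ne'
      (lp.single (E := fun _ : ℕ => ℝ) p (N + n) lam - lp.single p (N + m) lam) (N + n)
    have h2 : N + n ≠ N + m := by omega
    rw [lp.coeFn_sub, Pi.sub_apply, lp.single_apply_self, lp.single_apply_ne p _ _ h2, sub_zero,
      Real.norm_of_nonneg hlam.le] at h1
    exact h1
  · exact hsingle n lam (abs_of_pos hlam)
  · have := hsingle n (-lam) (by rw [abs_neg, abs_of_pos hlam])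
    rwa [lp.single_neg, ← sub_eq_add_neg] at this

theorem nontrivial_lp [Fact (1 ≤ p)] : Nontrivial (lp (fun _ : ℕ => ℝ) p) := by
  refine ⟨lp.single p 0 1, 0, fun h => ?_⟩
  have h1 := lp.norm_single (E := fun _ : ℕ => ℝ) (p := p) (zero_lt_one.trans_le Fact.out) 0 1
  rw [h] at h1
  simp at h1

end Lp

/-! ### Non-existence of coarse quotient maps -/

theorem not_isCoarseQuotient_lp {p q : ℝ≥0∞} [Fact (1 ≤ p)] [Fact (1 ≤ q)] (hp : 1 < p)
    (hpq : p < q) (hq : q < ⊤) :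
    ¬ IsCoarseQuotient (lp (fun _ : ℕ => ℝ) q) (lp (fun _ : ℕ => ℝ) p) := by
  intro h
  have := nontrivial_lp (p := q)
  obtain ⟨M, hM, hbound⟩ := h.exists_betaModulus_le
  have hptop : p ≠ ⊤ := (hpq.trans hq).ne
  obtain ⟨c, hc, hlow⟩ := exists_mul_rpow_le_betaModulus_lp hp hptop
  have hpq' : 0 < q.toReal - p.toReal :=
    sub_pos.2 ((ENNReal.toReal_lt_toReal hptop hq.ne).2 hpq)
  have hq0 : 0 < q.toReal := by linarith [ENNReal.toReal_nonneg (a := p)]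
  -- The bounds `c * (lam / M) ^ p ≤ 4 * lam ^ q` are incompatible for small `lam`.
  have hev : ∀ e : ℝ, 0 < e → ∀ C : ℝ, 0 < C → ∀ᶠ lam in 𝓝[>] (0 : ℝ), lam ^ e < C := by
    intro e he C hC
    have h1 : Tendsto (fun lam : ℝ => lam ^ e) (𝓝[>] 0) (𝓝 ((0 : ℝ) ^ e)) :=
      ((Real.continuous_rpow_const he.le).tendsto 0).mono_left nhdsWithin_le_nhds
    rw [Real.zero_rpow he.ne'] at h1
    exact h1.eventually_lt_const hC
  obtain ⟨lam, h1, h2, h3, h4⟩ := ((hev _ hpq' (c / (4 * M ^ p.toReal)) (by positivity)).and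
    ((hev _ hq0 (1 / 2) (by norm_num)).and ((hev 1 one_pos M hM).and self_mem_nhdsWithin))).exists
  have hlam : 0 < lam := h4
  rw [Real.rpow_one] at h3
  have h5 := hbound lam (2 * lam ^ q.toReal) hlam (by positivity) (by linarith)
    (hasSmoothForks_lp hq.ne hlam)
  have h6 := hlow (lam / M) (by positivity) (by rw [div_le_one hM]; exact h3.le)
  rw [Real.div_rpow hlam.le hM.le] at h6
  rw [Real.rpow_sub hlam, div_lt_div_iff₀ (by positivity) (by positivity)] at h1
  have h7 := h6.trans h5
  rw [← mul_div_assoc, div_le_iff₀ (by positivity)] at h7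
  linarith

theorem not_isCoarseQuotient_c0_of_hasPropertyBeta {X : Type*} [NormedAddCommGroup X]
    [NormedSpace ℝ X] (hX : HasPropertyBeta X) : ¬ IsCoarseQuotient C₀(ℕ, ℝ) X := by
  intro h
  obtain ⟨M, hM, hbound⟩ := h.exists_betaModulus_le
  have hpos := hX (1 / M) (by positivity)
  set ρ := min 1 (betaModulus X (1 / M) / 4)
  have hρ : 0 < ρ := lt_min one_pos (by positivity)
  have h1 := hbound 1 ρ one_pos hρ.le (min_le_left _ _) (hasSmoothForks_c0 hρ)
  have h2 : ρ ≤ betaModulus X (1 / M) / 4 := min_le_right _ _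
  linarith

theorem mainTheorem4 :
    (∀ (p q : ℝ≥0∞) [Fact (1 ≤ p)] [Fact (1 ≤ q)], 1 < p → p < q → q < ⊤ →
      ¬ IsCoarseQuotient (lp (fun _ : ℕ => ℝ) q) (lp (fun _ : ℕ => ℝ) p)) ∧
    (∀ (X : Type*) [NormedAddCommGroup X] [NormedSpace ℝ X] [CompleteSpace X],
      HasPropertyBeta X → ¬ IsCoarseQuotient C₀(ℕ, ℝ) X) :=
  ⟨fun _ _ _ _ hp hpq hq => not_isCoarseQuotient_lp hp hpq hq,
    fun _ _ _ _ hX => not_isCoarseQuotient_c0_of_hasPropertyBeta hX⟩
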